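/- Let $G$ be a finite simple undirected graph with vertex set $V$, and write $N(x)$ for the set of neighbors of $x\in V$. A set $S\subseteq V$ is called a $q$-set if $|S|\ge 2$ and for every $u\in S$ there is $v\in S$, $v\ne u$, with $N(u)\cap N(v)\neq\emptyset$. The graph $G$ is called s-quadrangular if for every $q$-set $S$ $$\Bigl|\bigcup\{N(u)\cap N(v) : u,v\in S,\ u\ne v\}\Bigr|\ge |S|$$ (equivalently, the digraph obtained from $G$ by replacing each edge $xy$ by the two arcs $xy$ and $yx$ satisfies this condition both for out-neighborhoods and for in-neighborhoods). Theorem 3.4. Let $G$ be a connected s-quadrangular graph with at least three vertices in which every vertex has degree at most $4$. Then $G$ is hamiltonian, i.e. $G$ has a cycle containing every vertex of $G$. -/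

import Mathlib

namespace Digraph

variable {V : Type*}

/-- The set `N⁺(x)` of out-neighbors of `x`. -/
def outNbhd (D : Digraph V) (x : V) : Set V := {y | D.Adj x y}

/-- The set `N⁻(x)` of in-neighbors of `x`. -/
def inNbhd (D : Digraph V) (x : V) : Set V := {y | D.Adj y x}

/-- A `q⁺`-set: at least two vertices, and every vertex of `S` has a common out-neighbor with
another vertex of `S`. -/
def IsQPlusSet (D : Digraph V) (S : Set V) : Prop :=
  S.Nontrivial ∧ ∀ u ∈ S, ∃ v ∈ S, v ≠ u ∧ (D.outNbhd u ∩ D.outNbhd v).Nonempty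

/-- A `q⁻`-set: at least two vertices, and every vertex of `S` has a common in-neighbor with
another vertex of `S`. -/
def IsQMinusSet (D : Digraph V) (S : Set V) : Prop :=
  S.Nontrivial ∧ ∀ u ∈ S, ∃ v ∈ S, v ≠ u ∧ (D.inNbhd u ∩ D.inNbhd v).Nonempty

/-- The union of `N⁺(u) ∩ N⁺(v)` over all pairs of distinct vertices `u, v ∈ S`. -/
def commonOut (D : Digraph V) (S : Set V) : Set V :=
  {w | ∃ u ∈ S, ∃ v ∈ S, u ≠ v ∧ w ∈ D.outNbhd u ∩ D.outNbhd v}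

/-- The union of `N⁻(u) ∩ N⁻(v)` over all pairs of distinct vertices `u, v ∈ S`. -/
def commonIn (D : Digraph V) (S : Set V) : Set V :=
  {w | ∃ u ∈ S, ∃ v ∈ S, u ≠ v ∧ w ∈ D.inNbhd u ∩ D.inNbhd v}

/-- A digraph (on a finite vertex set) is s-quadrangular if every `q⁺`-set `S` has at least `|S|`
vertices dominated by two distinct vertices of `S`, and every `q⁻`-set `S` has at least `|S|`
vertices dominating two distinct vertices of `S`. -/
def IsSQuadrangular (D : Digraph V) : Prop :=
  (∀ S : Set V, D.IsQPlusSet S → S.ncard ≤ (D.commonOut S).ncard) ∧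
    (∀ S : Set V, D.IsQMinusSet S → S.ncard ≤ (D.commonIn S).ncard)

end Digraph

namespace SimpleGraph

variable {V : Type*}

/-- The complete biorientation: every edge `xy` is replaced by the two arcs `xy` and `yx`. -/
def completeBiorientation (G : SimpleGraph V) : Digraph V where
  Adj x y := G.Adj x y

/-- A graph is s-quadrangular if its complete biorientation is. -/
def IsSQuadrangular (G : SimpleGraph V) : Prop :=
  G.completeBiorientation.IsSQuadrangular

end SimpleGraph

/-! A permutation moving every vertex to a neighbour is a spanning family of disjoint cycles, with
single edges as 2-cycles. The s-quadrangular condition implies Hall's condition, so one exists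
(`exists_isAdjPerm`). Minimum degree two allows a non-involutive one, which is then replaced by one
whose cycles are maximally coarse (`IsCoarsest`). If an edge joins two cycles, coarseness forbids
all edges that would merge them, while two vertices with a common neighbour always have a second
one. With degree at most 4 few configurations survive. An edge between two long cycles forces
4-cycles attached at antipodal vertices (`long_long`), and no edge joins a 2-cycle to a long cycle
(`not_adj_of_two_of_long`); by connectivity all cycles are long. If every vertex had a neighbour off
its cycle, following such edges would close up and merge several cycles, so some vertex has none
(`exists_forall_sameCycle`). But having one spreads along cycles (`exists_adj_apply`) and across
edges between cycles. Hence no vertex has one, and connectivity leaves a single cycle. -/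

namespace SimpleGraph

variable {V : Type*}

/-! ### Closed walks as vertex lists. -/

/-- `l` lists the vertices of a walk of `G` that starts at `a` and ends at `b`. -/
structure Traces (G : SimpleGraph V) (l : List V) (a b : V) : Prop where
  chain : l.IsChain G.Adj
  head : l.head? = some a
  last : l.getLast? = some b

namespace Traces

variable {G : SimpleGraph V} {l l' : List V} {a b c d : V}

lemma singleton (a : V) : G.Traces [a] a a := ⟨by simp, by simp, by simp⟩

lemma append (h : G.Traces l a b) (h' : G.Traces l' c d) (hbc : G.Adj b c) :
    G.Traces (l ++ l') a d := by
  refine ⟨?_, ?_, ?_⟩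
  · rw [List.isChain_append]
    refine ⟨h.chain, h'.chain, ?_⟩
    simp [h.last, h'.head, hbc]
  · simp [List.head?_append, h.head]
  · simp [List.getLast?_append, h'.last]

lemma reverse (h : G.Traces l a b) : G.Traces l.reverse b a := by
  refine ⟨?_, ?_, ?_⟩
  · rw [List.isChain_reverse]
    exact h.chain.imp fun _ _ h => h.symm
  · simp [h.last]
  · simp [h.head]

lemma exists_walk (h : G.Traces l a b) : ∃ p : G.Walk a b, p.support = l := by
  obtain ⟨hc, hh, hl⟩ := h
  induction l generalizing a with
  | nil => simp at hh
  | cons x t ih =>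
    obtain rfl : x = a := by simpa using hh
    cases t with
    | nil =>
      obtain rfl : x = b := by simpa using hl
      exact ⟨.nil, rfl⟩
    | cons y t =>
      rw [List.isChain_cons_cons] at hc
      obtain ⟨p, hp⟩ := ih (a := y) hc.2 rfl (by simpa using hl)
      exact ⟨.cons hc.1 p, by simp [hp]⟩

lemma adj_formPerm [DecidableEq V] (h : G.Traces l a b) (hn : l.Nodup) (hba : G.Adj b a)
    {x : V} (hx : x ∈ l) : G.Adj x (l.formPerm x) := by
  obtain ⟨i, hi, rfl⟩ := List.getElem_of_mem hx
  rw [List.formPerm_apply_getElem _ hn]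
  by_cases hi' : i + 1 < l.length
  · simp only [Nat.mod_eq_of_lt hi']
    exact List.isChain_iff_getElem.1 h.chain i hi'
  · have e : i + 1 = l.length := by omega
    simp only [e, Nat.mod_self]
    have h1 := h.last
    have h2 := h.head
    rw [List.getLast?_eq_getElem?, List.getElem?_eq_some_iff] at h1
    rw [List.head?_eq_getElem?, List.getElem?_eq_some_iff] at h2
    obtain ⟨_, h1⟩ := h1
    obtain ⟨_, h2⟩ := h2
    rw [h2]
    convert hba
    rw [← h1]
    congr 1
    omega

end Traces

/-- A traced closed walk through all vertices, without repetition, is a Hamiltonian cycle. -/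
lemma Traces.isHamiltonian [Fintype V] [DecidableEq V] {G : SimpleGraph V} {l : List V} {a b : V}
    (h : G.Traces l a b) (hn : l.Nodup) (hba : G.Adj b a) (hall : ∀ x, x ∈ l)
    (hcard : 3 ≤ Fintype.card V) : G.IsHamiltonian := by
  intro _
  obtain ⟨p, rfl⟩ := h.exists_walk
  have hp : p.IsPath := (Walk.isPath_def p).2 hn
  have hlen : p.length + 1 = Fintype.card V := by
    rw [← Walk.length_support, ← List.toFinset_card_of_nodup hn]
    have : p.support.toFinset = Finset.univ := by ext x; simp [hall x]
    rw [this, Finset.card_univ]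
  refine ⟨b, .cons hba p, ?_⟩
  rw [Walk.isHamiltonianCycle_iff_isCycle_and_length_eq]
  refine ⟨?_, by simpa using hlen⟩
  rw [Walk.cons_isCycle_iff]
  refine ⟨hp, fun he => ?_⟩
  rw [Sym2.eq_swap] at he
  have := hp.length_eq_one_of_mem_edges he
  omega

/-! ### Adjacency permutations and merging of their cycles. -/

/-- Every vertex is adjacent to its image. -/
def IsAdjPerm (G : SimpleGraph V) (σ : Equiv.Perm V) : Prop := ∀ v, G.Adj v (σ v)

/-- An adjacency permutation whose partition into cycles is maximally coarse. -/
structure IsCoarsest (G : SimpleGraph V) (σ : Equiv.Perm V) : Prop where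
  adj : G.IsAdjPerm σ
  max : ∀ τ, G.IsAdjPerm τ → (∀ a b, σ.SameCycle a b → τ.SameCycle a b) →
    ∀ a b, τ.SameCycle a b → σ.SameCycle a b

lemma IsAdjPerm.inv {G : SimpleGraph V} {σ : Equiv.Perm V} (h : G.IsAdjPerm σ) :
    G.IsAdjPerm σ⁻¹ := fun v => by simpa using (h (σ⁻¹ v)).symm

lemma IsCoarsest.inv {G : SimpleGraph V} {σ : Equiv.Perm V} (h : G.IsCoarsest σ) :
    G.IsCoarsest σ⁻¹ :=
  ⟨h.adj.inv, fun τ hτ h1 a b hab => by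
    simpa using h.max τ hτ (fun a b hab => h1 a b (by simpa using hab)) a b hab⟩

lemma exists_isCoarsest [Fintype V] {G : SimpleGraph V} {σ : Equiv.Perm V} (h : G.IsAdjPerm σ) :
    ∃ τ, G.IsCoarsest τ ∧ ∀ a b, σ.SameCycle a b → τ.SameCycle a b := by
  classical
  let R : Equiv.Perm V → Finset (V × V) := fun τ => {p | τ.SameCycle p.1 p.2}
  let S : Set (Equiv.Perm V) := {τ | G.IsAdjPerm τ ∧ ∀ a b, σ.SameCycle a b → τ.SameCycle a b}
  obtain ⟨τ, hτ, hmax⟩ := S.toFinite.exists_maximalFor R S ⟨σ, h, fun _ _ => id⟩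
  refine ⟨τ, ⟨hτ.1, fun ρ hρ hle a b hab => ?_⟩, hτ.2⟩
  have : R ρ ≤ R τ := hmax ⟨hρ, fun a b hab => hle a b (hτ.2 a b hab)⟩
    (fun p hp => by simp only [R, Finset.mem_filter_univ] at hp ⊢; exact hle _ _ hp)
  have hm : (a, b) ∈ R ρ := by simpa [R] using hab
  simpa [R] using this hm

section Merge

variable [Fintype V] [DecidableEq V] {G : SimpleGraph V} {σ : Equiv.Perm V}

/-- A nodup closed walk that covers a union of cycles of a coarsest permutation covers one. -/
lemma IsCoarsest.sameCycle_of_traces (h : G.IsCoarsest σ) {l : List V} {a b : V}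
    (hl : G.Traces l a b) (hn : l.Nodup) (hba : G.Adj b a) (hσ : ∀ x, x ∈ l ↔ σ x ∈ l)
    {x y : V} (hx : x ∈ l) (hy : y ∈ l) : σ.SameCycle x y := by
  classical
  -- Rotating along `l` and keeping `σ` elsewhere gives an adjacency permutation at least as coarse
  -- as `σ`, with all of `l` on one cycle.
  let f : V → V := fun x => if x ∈ l then l.formPerm x else σ x
  have hf : Function.Injective f := by
    intro u v huv
    simp only [f] at huv
    split_ifs at huv with hu hv hv
    · exact l.formPerm.injective huv
    · exact absurd ((hσ v).2 (huv ▸ List.formPerm_apply_mem_of_mem hu)) hv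
    · exact absurd ((hσ u).2 (huv ▸ List.formPerm_apply_mem_of_mem hv)) hu
    · exact σ.injective huv
  let τ : Equiv.Perm V := Equiv.ofBijective f (Finite.injective_iff_bijective.1 hf)
  have hτ : ∀ x, τ x = if x ∈ l then l.formPerm x else σ x := fun _ => rfl
  have hlen : 2 ≤ l.length := by
    rcases l with _ | ⟨u, _ | ⟨v, t⟩⟩
    · simp at hx
    · have h1 := hl.head
      have h2 := hl.last
      simp only [List.head?_cons, Option.some.injEq, List.getLast?_singleton] at h1 h2
      exact absurd hba (by rw [← h1, ← h2]; simp)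
    · simp
  have hpow : ∀ n : ℕ, ∀ u ∈ l, (τ ^ n) u = (l.formPerm ^ n) u ∧ (l.formPerm ^ n) u ∈ l := by
    intro n u hu
    induction n with
    | zero => simpa
    | succ n ih =>
      simp only [pow_succ', Equiv.Perm.mul_apply, ih.1]
      rw [hτ, if_pos ih.2]
      exact ⟨rfl, List.formPerm_apply_mem_of_mem ih.2⟩
  have hin : ∀ u ∈ l, ∀ v ∈ l, τ.SameCycle u v := by
    intro u hu v hv
    have hc := List.isCycle_formPerm hn hlen
    have hne : ∀ w ∈ l, l.formPerm w ≠ w := fun w hw =>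
      (List.formPerm_apply_mem_ne_self_iff _ hn w hw).2 hlen
    obtain ⟨n, hn'⟩ := (hc.sameCycle (hne u hu) (hne v hv)).exists_nat_pow_eq
    exact ⟨n, by rw [zpow_natCast, (hpow n u hu).1, hn']⟩
  have hout : ∀ n : ℕ, ∀ u, u ∉ l → (τ ^ n) u = (σ ^ n) u ∧ (σ ^ n) u ∉ l := by
    intro n u hu
    induction n with
    | zero => simpa
    | succ n ih =>
      simp only [pow_succ', Equiv.Perm.mul_apply, ih.1]
      rw [hτ, if_neg ih.2]
      exact ⟨rfl, fun hm => ih.2 ((hσ _).2 hm)⟩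
  have hσn : ∀ n : ℕ, ∀ u ∈ l, (σ ^ n) u ∈ l := by
    intro n u hu
    induction n with
    | zero => simpa
    | succ n ih =>
      simp only [pow_succ', Equiv.Perm.mul_apply]
      exact (hσ _).1 ih
  refine h.max τ (fun v => ?_) (fun u v huv => ?_) x y (hin x hx y hy)
  · rw [hτ]
    split_ifs with hv
    · exact hl.adj_formPerm hn hba hv
    · exact h.adj v
  · obtain ⟨n, rfl⟩ := huv.exists_nat_pow_eq
    by_cases hu : u ∈ l
    · exact hin u hu _ (hσn n u hu)
    · exact ⟨n, by rw [zpow_natCast, (hout n u hu).1]⟩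

omit [Fintype V] [DecidableEq V] in
lemma IsAdjPerm.apply_ne (h : G.IsAdjPerm σ) (v : V) : σ v ≠ v := (h v).ne'

lemma IsAdjPerm.mem_toList (h : G.IsAdjPerm σ) {u v : V} : v ∈ σ.toList u ↔ σ.SameCycle u v := by
  rw [Equiv.Perm.mem_toList_iff, Equiv.Perm.mem_support]
  exact and_iff_left (h.apply_ne u)

lemma isChain_toList (v : V) : (σ.toList v).IsChain fun a b => b = σ a := by
  rw [List.isChain_iff_getElem]
  intro i hi
  rw [Equiv.Perm.getElem_toList, Equiv.Perm.getElem_toList, pow_succ', Equiv.Perm.mul_apply]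

lemma IsAdjPerm.traces_toList (h : G.IsAdjPerm σ) (v : V) :
    G.Traces (σ.toList v) v (σ⁻¹ v) := by
  have hv : v ∈ σ.support := by simpa using h.apply_ne v
  have hpos := Equiv.Perm.length_toList_pos_of_mem_support σ v hv
  refine ⟨(isChain_toList v).imp fun a b (hab : b = σ a) => hab ▸ h a, ?_, ?_⟩
  · rw [List.head?_eq_getElem?, List.getElem?_eq_some_iff]
    exact ⟨hpos, Equiv.Perm.toList_getElem_zero _ _ hv⟩
  · rw [List.getLast?_eq_getElem?, List.getElem?_eq_some_iff]
    refine ⟨by omega, ?_⟩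
    rw [Equiv.Perm.eq_inv_iff_eq, Equiv.Perm.getElem_toList, ← Equiv.Perm.mul_apply, ← pow_succ',
      Nat.sub_add_cancel hpos, Equiv.Perm.length_toList]
    have := (σ.isCycle_cycleOf (h.apply_ne v)).orderOf
    rw [← this, ← Equiv.Perm.cycleOf_pow_apply_self, pow_orderOf_eq_one, Equiv.Perm.one_apply]

/-- Vertices next to a chord between two cycles are not adjacent. -/
lemma IsCoarsest.not_adj_inv_apply (h : G.IsCoarsest σ) {u v : V} (hD : ¬ σ.SameCycle u v)
    (huv : G.Adj u v) : ¬ G.Adj (σ⁻¹ u) (σ v) := by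
  intro hadj
  have h1 : G.Traces (σ.toList (σ v)) (σ v) v := by simpa using h.adj.traces_toList (σ v)
  have h2 := h1.append (h.adj.traces_toList u) huv.symm
  have hm : ∀ x, x ∈ σ.toList (σ v) ++ σ.toList u ↔ σ.SameCycle v x ∨ σ.SameCycle u x := fun x => by
    simp [h.adj.mem_toList]
  refine hD (h.sameCycle_of_traces h2 ?_ hadj (fun x => ?_) ((hm _).2 (.inr (.refl _ _)))
    ((hm _).2 (.inl (.refl _ _))))
  · refine List.Nodup.append (σ.nodup_toList _) (σ.nodup_toList _) fun x hx hx' => ?_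
    rw [h.adj.mem_toList, Equiv.Perm.sameCycle_apply_left] at hx
    rw [h.adj.mem_toList] at hx'
    exact hD (hx'.trans hx.symm)
  · simp [hm]

lemma IsCoarsest.not_adj_inv_inv (h : G.IsCoarsest σ) {u v : V} (hD : ¬ σ.SameCycle u v)
    (huv : G.Adj u v) : ¬ G.Adj (σ⁻¹ u) (σ⁻¹ v) := by
  intro hadj
  have h2 := (h.adj.traces_toList v).reverse.append (h.adj.traces_toList u) huv.symm
  have hm : ∀ x, x ∈ (σ.toList v).reverse ++ σ.toList u ↔ σ.SameCycle v x ∨ σ.SameCycle u x :=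
    fun x => by simp [h.adj.mem_toList]
  refine hD (h.sameCycle_of_traces h2 ?_ hadj (fun x => ?_) ((hm _).2 (.inr (.refl _ _)))
    ((hm _).2 (.inl (.refl _ _))))
  · refine List.Nodup.append (by simpa using σ.nodup_toList _) (σ.nodup_toList _) fun x hx hx' => ?_
    rw [List.mem_reverse, h.adj.mem_toList] at hx
    rw [h.adj.mem_toList] at hx'
    exact hD (hx'.trans hx.symm)
  · simp [hm]

lemma IsCoarsest.not_adj_apply_inv (h : G.IsCoarsest σ) {u v : V} (hD : ¬ σ.SameCycle u v)
    (huv : G.Adj u v) : ¬ G.Adj (σ u) (σ⁻¹ v) := by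
  simpa using h.inv.not_adj_inv_apply (by simpa using hD) huv

lemma IsCoarsest.not_adj_apply_apply (h : G.IsCoarsest σ) {u v : V} (hD : ¬ σ.SameCycle u v)
    (huv : G.Adj u v) : ¬ G.Adj (σ u) (σ v) := by
  simpa using h.inv.not_adj_inv_inv (by simpa using hD) huv

/-- A 2-cycle can be inserted into a long cycle along two crossing chords. -/
lemma IsCoarsest.not_adj_of_chord (h : G.IsCoarsest σ) {u v w : V} (hu : σ (σ u) = u)
    (hD : ¬ σ.SameCycle u v) (huv : G.Adj u v) (hw : G.Adj w (σ u)) (hvw : G.Adj v w)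
    (hs : σ.SameCycle v w) (h1 : w ≠ σ v) (h2 : v ≠ σ w) : ¬ G.Adj (σ v) (σ w) := by
  intro hadj
  have hwm : w ∈ σ.toList v := h.adj.mem_toList.2 hs
  have htr := h.adj.traces_toList v
  have hch := isChain_toList (σ := σ) v
  have hnd := σ.nodup_toList v
  have hmem : ∀ x, x ∈ σ.toList v ↔ σ.SameCycle v x := fun x => h.adj.mem_toList
  obtain ⟨s, t, hst⟩ := List.append_of_mem hwm
  have hlast := htr.last
  rw [hst] at hlast hch hnd hmem
  rcases s with _ | ⟨v', A⟩
  · have := htr.head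
    rw [hst] at this
    simp only [List.nil_append, List.head?_cons, Option.some.injEq] at this
    exact hvw.ne this.symm
  obtain rfl : v' = v := by simpa [hst] using htr.head
  have hAne : A ≠ [] := by
    rintro rfl
    simp only [List.cons_append, List.nil_append, List.isChain_cons_cons] at hch
    exact h1 hch.1
  have hBne : t ≠ [] := by
    rintro rfl
    simp only [List.getLast?_append, List.getLast?_singleton, Option.some_or,
      Option.some.injEq] at hlast
    exact h2 (by rw [hlast]; simp)
  simp only [List.cons_append, List.isChain_cons, List.isChain_append] at hch
  obtain ⟨hA1, hA2, ⟨hB1, hB2⟩, hA3⟩ := hch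
  have hA : G.Traces A (σ v') (σ⁻¹ w) := by
    refine ⟨hA2.imp fun a b (hab : b = σ a) => hab ▸ h.adj a, ?_, ?_⟩
    · rw [List.head?_eq_some_head hAne]
      congr 1
      exact hA1 _ (by simp [List.head?_append, List.head?_eq_some_head hAne])
    · rw [List.getLast?_eq_some_getLast hAne]
      congr 1
      rw [Equiv.Perm.eq_inv_iff_eq]
      exact (hA3 _ (by simp [List.getLast?_eq_some_getLast hAne]) w (by simp)).symm
  have hB : G.Traces t (σ w) (σ⁻¹ v') := by
    refine ⟨hB2.imp fun a b (hab : b = σ a) => hab ▸ h.adj a, ?_, ?_⟩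
    · rw [List.head?_eq_some_head hBne]
      congr 1
      exact hB1 _ (by simp [List.head?_eq_some_head hBne])
    · rw [← hlast, List.getLast?_append_of_ne_nil _ (by simp), ← List.singleton_append,
        List.getLast?_append_of_ne_nil _ hBne]
  -- The merged cycle is `v`, then backwards from `σ⁻¹ v` to `σ w`, across to `σ v`, forwards to
  -- `w`, and home through `σ u`, `u`.
  have key := (((((Traces.singleton v').append hB.reverse (h.adj.inv v')).append hA
    hadj.symm).append (.singleton w) (by simpa using h.adj (σ⁻¹ w))).append (.singleton (σ u))
      hw).append (.singleton u) (by simpa [hu] using h.adj (σ u))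
  have hm : ∀ x, x ∈ [v'] ++ t.reverse ++ A ++ [w] ++ [σ u] ++ [u] ↔
      σ.SameCycle v' x ∨ x = u ∨ x = σ u := by
    intro x
    rw [← hmem]
    simp only [List.mem_append, List.mem_cons, List.mem_reverse, List.not_mem_nil, or_false]
    tauto
  have hu' : ¬ σ.SameCycle v' u := fun h => hD h.symm
  have hsu' : ¬ σ.SameCycle v' (σ u) := fun h => hD (by simpa using h.symm)
  refine hD (h.sameCycle_of_traces key ?_ huv (fun x => ?_) ((hm _).2 (.inr (.inl rfl)))
    ((hm _).2 (.inl (.refl _ _))))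
  · have hp : ([v'] ++ t.reverse ++ A ++ [w] ++ [σ u] ++ [u]).Perm
        (u :: σ u :: (v' :: A ++ w :: t)) := by
      rw [List.perm_iff_count]
      intro a
      simp only [List.count_append, List.count_cons, List.count_reverse, List.count_nil]
      omega
    rw [hp.nodup_iff, List.nodup_cons, List.nodup_cons, List.mem_cons, hmem, hmem]
    exact ⟨by simp [hu', (h.adj.apply_ne u).symm], hsu', hnd⟩
  · rw [hm, hm, Equiv.Perm.sameCycle_apply_right, σ.apply_eq_iff_eq]
    have : σ x = u ↔ x = σ u := by rw [← σ.apply_eq_iff_eq (x := x), hu]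
    rw [this]
    tauto

end Merge

end SimpleGraph

/-! ### Local structure around an edge between two cycles. -/

namespace SimpleGraph

variable {V : Type*}

/-- The local properties of a coarsest adjacency permutation `s` with inverse `p` in an
s-quadrangular graph of maximum degree at most four; `R` is the relation of lying on a common
cycle. -/
structure Rotation (G : SimpleGraph V) (s p : V → V) (R : V → V → Prop) : Prop where
  sp : ∀ x, s (p x) = x
  ps : ∀ x, p (s x) = x
  adj : ∀ x, G.Adj x (s x)
  equiv : Equivalence R
  step : ∀ x, R x (s x)
  iter : ∀ x y, R x y → ∃ n : ℕ, y = s^[n] x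
  ss : ∀ u v, ¬ R u v → G.Adj u v → ¬ G.Adj (s u) (s v)
  sp' : ∀ u v, ¬ R u v → G.Adj u v → ¬ G.Adj (s u) (p v)
  pp : ∀ u v, ¬ R u v → G.Adj u v → ¬ G.Adj (p u) (p v)
  chord_s : ∀ u v w, s (s u) = u → ¬ R u v → G.Adj u v → G.Adj w (s u) → G.Adj v w → R v w →
    w ≠ s v → v ≠ s w → ¬ G.Adj (s v) (s w)
  chord_p : ∀ u v w, p (p u) = u → ¬ R u v → G.Adj u v → G.Adj w (p u) → G.Adj v w → R v w →
    w ≠ p v → v ≠ p w → ¬ G.Adj (p v) (p w)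
  quad : ∀ a b c, a ≠ b → G.Adj a c → G.Adj b c → ∃ d, d ≠ c ∧ G.Adj a d ∧ G.Adj b d
  four : ∀ v a b c d x, a ≠ b → a ≠ c → a ≠ d → b ≠ c → b ≠ d → c ≠ d → G.Adj v a → G.Adj v b →
    G.Adj v c → G.Adj v d → G.Adj v x → x = a ∨ x = b ∨ x = c ∨ x = d

namespace Rotation

variable {G : SimpleGraph V} {s p : V → V} {R : V → V → Prop} {u v w x y : V}

lemma step' (h : G.Rotation s p R) (x : V) : R x (p x) := by
  have := h.step (p x)
  rw [h.sp] at this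
  exact h.equiv.symm this

lemma adj' (h : G.Rotation s p R) (x : V) : G.Adj x (p x) := by
  have := h.adj (p x)
  rw [h.sp] at this
  exact this.symm

lemma symm (h : G.Rotation s p R) (hxy : R x y) : R y x := h.equiv.symm hxy

lemma trans (h : G.Rotation s p R) {z : V} (hxy : R x y) (hyz : R y z) : R x z :=
  h.equiv.trans hxy hyz

lemma not_symm (h : G.Rotation s p R) (hxy : ¬ R x y) : ¬ R y x := fun h' => hxy (h.symm h')

lemma ps' (h : G.Rotation s p R) : ∀ u v, ¬ R u v → G.Adj u v → ¬ G.Adj (p u) (s v) :=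
  fun _ _ hR ha ha' => h.sp' _ _ (h.not_symm hR) ha.symm ha'.symm

lemma ne (h : G.Rotation s p R) (hxy : ¬ R x y) : x ≠ y := fun e => hxy (e ▸ h.equiv.refl x)

/-- Reversing all cycles swaps `s` and `p`, so each later result also holds in mirror form. -/
lemma inv (h : G.Rotation s p R) : G.Rotation p s R where
  sp := h.ps
  ps := h.sp
  adj := h.adj'
  equiv := h.equiv
  step := h.step'
  iter x y hxy := by
    obtain ⟨n, hn⟩ := h.iter y x (h.symm hxy)
    refine ⟨n, ?_⟩
    rw [hn]
    exact ((Function.LeftInverse.iterate h.ps n) y).symm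
  ss := h.pp
  sp' := h.ps'
  pp := h.ss
  chord_s := h.chord_p
  chord_p := h.chord_s
  quad := h.quad
  four := h.four

lemma eq_or_of_two (h : G.Rotation s p R) (hx : s (s x) = x) (hxy : R x y) :
    y = x ∨ y = s x := by
  obtain ⟨n, rfl⟩ := h.iter x y hxy
  clear hxy
  induction n with
  | zero => simp
  | succ n ih =>
    rw [Function.iterate_succ_apply']
    grind

lemma eq_or_of_four (h : G.Rotation s p R) (hx : s (s (s (s x))) = x) (hxy : R x y) :
    y = x ∨ y = s x ∨ y = s (s x) ∨ y = s (s (s x)) := by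
  obtain ⟨n, rfl⟩ := h.iter x y hxy
  clear hxy
  induction n with
  | zero => simp
  | succ n ih =>
    rw [Function.iterate_succ_apply']
    grind

lemma eq_or_of_six (h : G.Rotation s p R) (hx : s (s (s (s (s (s x))))) = x) (hxy : R x y) :
    y = x ∨ y = s x ∨ y = s (s x) ∨ y = s (s (s x)) ∨ y = s (s (s (s x))) ∨
      y = s (s (s (s (s x)))) := by
  obtain ⟨n, rfl⟩ := h.iter x y hxy
  clear hxy
  induction n with
  | zero => simp
  | succ n ih =>
    rw [Function.iterate_succ_apply']
    grind

lemma long_of_rel (h : G.Rotation s p R) (hx : s (s x) ≠ x) (hxy : R x y) : s (s y) ≠ y := by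
  intro hy
  rcases h.eq_or_of_two hy (h.symm hxy) with rfl | rfl <;> grind

/-- `w` is the second common neighbour of `s u` and `v`. Coarseness keeps it off `s v` and `p v`, so
it completes the neighbourhood of `v`; the same argument for `p u` must then produce the same
vertex. -/
lemma exists_fourth (h : G.Rotation s p R) (hR : ¬ R u v) (huv : G.Adj u v) (hv : s (s v) ≠ v) :
    ∃ w, w ≠ u ∧ w ≠ s v ∧ w ≠ p v ∧ (∀ x, G.Adj v x → x = s v ∨ x = p v ∨ x = u ∨ x = w) ∧
      G.Adj v w ∧ G.Adj (s u) w ∧ G.Adj (p u) w := by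
  have hsv : ∀ x, R u x → x ≠ s v := fun x hx e =>
    hR (h.trans hx (e ▸ h.symm (h.step v)))
  have hpv : ∀ x, R u x → x ≠ p v := fun x hx e =>
    hR (h.trans hx (e ▸ h.symm (h.step' v)))
  have hne : s v ≠ p v := by have := h.sp v; grind
  obtain ⟨w, hwu, hsw, hvw⟩ := h.quad (s u) v u (by rintro rfl; exact hR (h.step u))
    (h.adj u).symm huv.symm
  obtain ⟨w', hwu', hpw, hvw'⟩ := h.quad (p u) v u (by rintro rfl; exact hR (h.step' u))
    (h.adj' u).symm huv.symm
  have h1 : w ≠ s v := by rintro rfl; exact h.ss _ _ hR huv hsw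
  have h2 : w ≠ p v := by rintro rfl; exact h.sp' _ _ hR huv hsw
  have h3 : w' ≠ s v := by rintro rfl; exact h.ps' _ _ hR huv hpw
  have h4 : w' ≠ p v := by rintro rfl; exact h.pp _ _ hR huv hpw
  have key := fun x => h.four v (s v) (p v) u w x hne (hsv u (h.equiv.refl u)).symm h1.symm
    (hpv u (h.equiv.refl u)).symm h2.symm hwu.symm (h.adj v) (h.adj' v) huv.symm hvw
  have : w' = w := by
    rcases key w' hvw' with e | e | e | e
    exacts [absurd e h3, absurd e h4, absurd e hwu', e]
  exact ⟨w, hwu, h1, h2, key, hvw, hsw, this ▸ hpw⟩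

/-- A second common neighbour of `s w` and `v` has no place: `s v` and `p v` would allow a merge
along `v w`, and `u` a merge along `s u`–`w`. -/
lemma long_of_third (h : G.Rotation s p R) (hu : ¬ R u w) (hv : ¬ R v w)
    (hnv : ∀ x, G.Adj v x → x = s v ∨ x = p v ∨ x = u ∨ x = w) (hvw : G.Adj v w)
    (hsw : G.Adj (s u) w) : s (s w) ≠ w := by
  intro hw
  obtain ⟨t, htw, hst, hvt⟩ := h.quad (s w) v w (by
    rintro rfl; exact hv (h.symm (h.step w))) (h.adj w).symm hvw
  rcases hnv t hvt with rfl | rfl | rfl | rfl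
  · exact h.ss _ _ (h.not_symm hv) hvw.symm hst
  · exact h.sp' _ _ (h.not_symm hv) hvw.symm hst
  · have := h.sp' w (s t) (fun h' => hu (h.trans (h.step t) (h.symm h'))) hsw.symm
    rw [h.ps] at this
    exact this hst
  · exact htw rfl

/-- A chord between two long cycles joins two antipodal pairs of 4-cycles. -/
lemma long_long (h : G.Rotation s p R) (hR : ¬ R u v) (huv : G.Adj u v) (hu : s (s u) ≠ u)
    (hv : s (s v) ≠ v) : s (s (s (s u))) = u ∧ G.Adj (s (s u)) v ∧
      ∀ x, G.Adj v x → x = s v ∨ x = p v ∨ x = u ∨ x = s (s u) := by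
  obtain ⟨w, hwu, hwsv, hwpv, hnv, hvw, hsw, hpw⟩ := h.exists_fourth hR huv hv
  have hne : s u ≠ p u := by have := h.sp u; grind
  -- On the cycle of `v`, or on a third cycle, `w` would have the five neighbours `s w`, `p w`, `s
  -- u`, `p u`, `v`. On the cycle of `u`, its cycle neighbours must be `s u` and `p u`, which closes
  -- a 4-cycle.
  by_cases hvw' : R v w
  · have hR' : ¬ R (s u) w := fun h' =>
      hR (h.trans (h.trans (h.step u) h') (h.symm hvw'))
    obtain ⟨r, -, -, -, hnw, -, -, -⟩ := h.exists_fourth hR' hsw (h.long_of_rel hv hvw')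
    have e1 := hnw _ hpw.symm
    have e2 := hnw _ hvw.symm
    have n1 : ∀ x, R u x → ¬ R w x := fun x hx hx' =>
      hR (h.trans hx (h.trans (h.symm hx') (h.symm hvw')))
    have f1 : p u ≠ s w := fun e => n1 _ (h.step' u) (e ▸ h.step w)
    have f2 : p u ≠ p w := fun e => n1 _ (h.step' u) (e ▸ h.step' w)
    have f3 : v ≠ s u := fun e => hR (e ▸ h.step u)
    have f4 : v ≠ p u := fun e => hR (e ▸ h.step' u)
    have := h.sp w
    have := h.ps w
    grind
  · by_cases huw : R u w
    · have hw := h.long_of_rel hu huw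
      obtain ⟨t, -, -, -, hnw, -, hst, hpt⟩ := h.exists_fourth hvw' hvw hw
      have f1 : ∀ x, R u x → x ≠ v := fun x hx e => hR (e ▸ hx)
      have f2 : s u ≠ t := by
        rintro rfl
        exact h.ss _ _ hR huv hst.symm
      have f3 : p u ≠ t := by
        rintro rfl
        exact h.ps' _ _ hR huv hst.symm
      have e1 := hnw _ hsw.symm
      have e2 := hnw _ hpw.symm
      have g1 := f1 _ (h.step u)
      have g2 := f1 _ (h.step' u)
      have := h.sp w
      have := h.ps w
      have := h.sp u
      have := h.ps u
      have hw' : w = s (s u) := by grind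
      have hw'' : s w = p u := by grind
      refine ⟨by grind, hw' ▸ hvw.symm, hw' ▸ hnv⟩
    · have hw := h.long_of_third huw hvw' hnv hvw hsw
      exfalso
      have f1 : ∀ x, R u x → x ≠ v := fun x hx e => hR (e ▸ hx)
      have f2 : ∀ x y, R u x → R w y → y ≠ x := fun x y hx hy e =>
        huw (h.trans hx (h.symm (e ▸ hy)))
      have f3 : ∀ x, R w x → x ≠ v := fun x hx e => hvw' (h.symm (e ▸ hx))
      have hne' : s w ≠ p w := by have := h.sp w; grind
      have := h.four w (s w) (p w) v (s u) (p u) hne' (f3 _ (h.step w)) (f2 _ _ (h.step u) (h.step w))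
        (f3 _ (h.step' w)) (f2 _ _ (h.step u) (h.step' w)) (f1 _ (h.step u)).symm
        (h.adj w) (h.adj' w) hvw.symm hsw.symm hpw.symm
      rcases this with e | e | e | e
      · exact f2 _ _ (h.step' u) (h.step w) e.symm
      · exact f2 _ _ (h.step' u) (h.step' w) e.symm
      · exact f1 _ (h.step' u) e
      · exact hne e.symm

/-- The structure around a chord `u v` from a 2-cycle `u, s u` to a long cycle. -/
structure Chord (G : SimpleGraph V) (s p : V → V) (R : V → V → Prop) (u v w : V) : Prop where
  rel : R v w
  adj : G.Adj v w
  adj' : G.Adj (s u) w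
  nbr_left : ∀ x, G.Adj v x → x = s v ∨ x = p v ∨ x = u ∨ x = w
  nbr_right : ∀ x, G.Adj w x → x = s w ∨ x = p w ∨ x = s u ∨ x = v
  ne_s : w ≠ s v
  ne_p : w ≠ p v
  ne_ss : w ≠ s (s v)
  ne_pp : w ≠ p (p v)
  adj_sp : G.Adj (s v) (p w)
  adj_ps : G.Adj (p v) (s w)

lemma two_inv (h : G.Rotation s p R) (hu : s (s u) = u) : p (p u) = u ∧ p u = s u := by
  have h1 : p u = s u := by
    rw [← h.ps (s u), hu]
  refine ⟨?_, h1⟩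
  rw [h1, h.ps]

lemma Chord.inv (h : G.Rotation s p R) (hu : s (s u) = u) (c : Chord G s p R u v w) :
    Chord G p s R u v w := by
  have e := (h.two_inv hu).2
  refine ⟨c.rel, c.adj, e ▸ c.adj', ?_, ?_, c.ne_p, c.ne_s, c.ne_pp, c.ne_ss, c.adj_ps,
    c.adj_sp⟩
  · intro x hx
    have := c.nbr_left x hx
    tauto
  · intro x hx
    have := c.nbr_right x hx
    rw [e]
    tauto

lemma Chord.swap (h : G.Rotation s p R) (hu : s (s u) = u) (huv : G.Adj u v)
    (c : Chord G s p R u v w) : Chord G s p R (s u) w v := by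
  refine ⟨h.symm c.rel, c.adj.symm, hu.symm ▸ huv, c.nbr_right, ?_, ?_, ?_, ?_, ?_,
    c.adj_ps.symm, c.adj_sp.symm⟩
  · rw [hu]; exact c.nbr_left
  · rintro rfl; exact c.ne_p (h.ps _).symm
  · rintro rfl; exact c.ne_s (h.sp _).symm
  · rintro rfl; exact c.ne_pp (by simp [h.ps])
  · rintro rfl; exact c.ne_ss (by simp [h.sp])

/-- If a vertex of a long cycle has a neighbour on a 2-cycle, then all its neighbours on other
cycles lie on 2-cycles. -/
lemma two_of_adj_two (h : G.Rotation s p R) (hu : s (s u) = u) (hR : ¬ R u v) (huv : G.Adj u v)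
    (hv : s (s v) ≠ v) (hvw : ¬ R v w) (ha : G.Adj v w) : s (s w) = w := by
  by_contra hw
  obtain ⟨h1, -, h2⟩ := h.long_long (h.not_symm hvw) ha.symm hw hv
  have hwu : ¬ R w u := fun h' => h.long_of_rel hw h' hu
  rcases h2 u huv.symm with e | e | e | e
  · exact hR (h.symm (e ▸ h.step v))
  · exact hR (h.symm (e ▸ h.step' v))
  · exact hwu (e ▸ h.equiv.refl _)
  · exact hwu (e ▸ h.trans (h.step w) (h.step _))

/-- If the fourth neighbour `w` of `v` left the cycle of `v`, its cycle would be long by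
`long_of_third` and short by `two_of_adj_two`. Inserting the 2-cycle rules out the edges `s v`–`s w`
and `p v`–`p w`, so the second common neighbours of `w` with `s v` and with `p v` can only be `p w`
and `s w`. -/
lemma exists_chord (h : G.Rotation s p R) (hu : s (s u) = u) (hR : ¬ R u v) (huv : G.Adj u v)
    (hv : s (s v) ≠ v) : ∃ w, Chord G s p R u v w := by
  obtain ⟨w, hwu, hwsv, hwpv, hnv, hvw, hsw, -⟩ := h.exists_fourth hR huv hv
  have hR' : ¬ R (s u) v := fun h' => hR (h.trans (h.step u) h')
  have hrel : R v w := by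
    by_contra hvw'
    have huw : ¬ R u w := by
      intro huw
      rcases h.eq_or_of_two hu huw with e | e
      · exact hwu e
      · exact hsw.ne e.symm
    exact h.long_of_third huw hvw' hnv hvw hsw (h.two_of_adj_two hu hR huv hv hvw' hvw)
  have hRw : ¬ R (s u) w := fun h' => hR' (h.trans h' (h.symm hrel))
  have hw := h.long_of_rel hv hrel
  obtain ⟨v', -, -, -, hnw', -, -, -⟩ := h.exists_fourth hRw hsw hw
  have hvw1 : v ≠ s w := by rintro rfl; exact hwpv (h.ps w).symm
  have hvw2 : v ≠ p w := by rintro rfl; exact hwsv (h.sp w).symm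
  have hv' : v' = v := by
    rcases hnw' v hvw.symm with e | e | e | e
    · exact absurd e hvw1
    · exact absurd e hvw2
    · exact absurd (e ▸ h.equiv.refl _) hR'
    · exact e.symm
  rw [hv'] at hnw'
  obtain ⟨hpu, hpu'⟩ := h.two_inv hu
  have hss := h.chord_s u v w hu hR huv hsw.symm hvw hrel hwsv hvw1
  have hpp := h.chord_p u v w hpu hR huv (hpu' ▸ hsw.symm) hvw hrel hwpv hvw2
  have hsp : G.Adj (s v) (p w) := by
    obtain ⟨t, htv, hst, hwt⟩ := h.quad (s v) w v hwsv.symm (h.adj v).symm hvw.symm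
    rcases hnw' t hwt with rfl | rfl | rfl | rfl
    · exact absurd hst hss
    · exact hst
    · exact absurd hst.symm (h.ss _ _ hR huv)
    · exact absurd rfl htv
  have hps : G.Adj (p v) (s w) := by
    obtain ⟨t, htv, hst, hwt⟩ := h.quad (p v) w v hwpv.symm (h.adj' v).symm hvw.symm
    rcases hnw' t hwt with rfl | rfl | rfl | rfl
    · exact hst
    · exact absurd hst hpp
    · exact absurd hst.symm (h.sp' _ _ hR huv)
    · exact absurd rfl htv
  refine ⟨w, hrel, hvw, hsw, hnv, hnw', hwsv, hwpv, ?_, ?_, hsp, hps⟩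
  · rintro rfl
    rw [h.ps] at hsp
    exact hsp.ne rfl
  · rintro rfl
    rw [h.sp] at hps
    exact hps.ne rfl

end Rotation
end SimpleGraph

/-! ### No edge joins a 2-cycle to a long cycle. -/

namespace SimpleGraph

variable {V : Type*}

namespace Rotation

variable {G : SimpleGraph V} {s p : V → V} {R : V → V → Prop} {u v w x y : V}

/-- `z` is the second common neighbour of `u` and `s v`. On the cycle of `v`, the chord at `z` makes
`s v` a cycle neighbour of `z`; on another long cycle, `long_long` leaves `z` no room for `u`. -/
lemma exists_next (h : G.Rotation s p R) (hu : s (s u) = u) (hR : ¬ R u v) (huv : G.Adj u v)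
    (hv : s (s v) ≠ v) : ∃ z, z ≠ v ∧ G.Adj u z ∧ G.Adj (s v) z ∧ ¬ R u z ∧
      (R v z → z = s (s v)) ∧ (¬ R v z → s (s z) = z) := by
  obtain ⟨z, hzv, huz, hvz⟩ := h.quad u (s v) v (by rintro rfl; exact hR (h.symm (h.step v)))
    huv (h.adj v).symm
  have hRz : ¬ R u z := by
    intro h'
    rcases h.eq_or_of_two hu h' with rfl | rfl
    · exact huz.ne rfl
    · exact h.ss _ _ hR huv hvz.symm
  refine ⟨z, hzv, huz, hvz, hRz, fun hvz' => ?_, fun hvz' => ?_⟩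
  · obtain ⟨w, c⟩ := h.exists_chord hu hRz huz (h.long_of_rel hv hvz')
    rcases c.nbr_left _ hvz.symm with e | e | e | e
    · exact absurd (by rw [← h.ps z, ← e, h.ps]) hzv
    · rw [e, h.sp]
    · exact absurd (e ▸ h.symm (h.step v)) hR
    · exact absurd (e ▸ c.adj') (h.ss _ _ hR huv)
  · by_contra hz
    have hRvz : ¬ R (s v) z := fun h' => hvz' (h.trans (h.step v) h')
    have hzu : ∀ x, R v x → u ≠ x := fun x hx e => hR (e ▸ h.symm hx)
    obtain ⟨-, -, hn⟩ := h.long_long hRvz hvz (h.long_of_rel hv (h.step v)) hz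
    rcases hn u huz.symm with e | e | e | e
    · exact hRz (e ▸ h.symm (h.step z))
    · exact hRz (e ▸ h.symm (h.step' z))
    · exact hzu _ (h.step v) e
    · exact hzu _ (h.trans (h.step v) (h.trans (h.step _) (h.step _))) e

lemma Chord.not_four (h : G.Rotation s p R) (c : Chord G s p R u v w) :
    s (s (s (s v))) ≠ v := by
  intro h4
  have h1 := h.eq_or_of_four h4 c.rel
  have h2 := c.adj.ne
  have h3 := c.ne_s
  have h5 := c.ne_p
  have h6 := c.ne_ss
  have h7 := h.ps (s (s (s v)))
  grind

lemma Chord.not_six (h : G.Rotation s p R) (c : Chord G s p R u v w)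
    (hw : w ≠ s (s (s v))) : s (s (s (s (s (s v))))) ≠ v := by
  intro h4
  have h1 := h.eq_or_of_six h4 c.rel
  have h2 := c.adj.ne
  have h3 := c.ne_s
  have h5 := c.ne_p
  have h6 := c.ne_ss
  have h6 := c.ne_pp
  have h7 := h.ps (s (s (s (s (s v)))))
  have h7 := h.ps (s (s (s (s v))))
  grind

/-- If the chords at `v` and `s (s v)` are not nested, `s v` already has four neighbours on its own
cycle. This forces `p (p w)` to be the fourth neighbour of `s u`; moving on from `w` and `w₂` then
makes the cycle too short for a chord. -/
lemma false_of_not_nested (h : G.Rotation s p R) {w₂ : V} (hu : s (s u) = u) (hR : ¬ R u v)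
    (huv : G.Adj u v) (hv : s (s v) ≠ v) (huv₂ : G.Adj u (s (s v))) (c : Chord G s p R u v w)
    (c₂ : Chord G s p R u (s (s v)) w₂) (hw₂ : w₂ ≠ p (p w)) : False := by
  have hR₂ : ¬ R u (s (s v)) := fun h' =>
    hR (h.trans h' (h.symm (h.trans (h.step v) (h.step _))))
  have hw3 : w ≠ s (s (s v)) := by
    rintro rfl
    exact h.ss _ _ hR₂ huv₂ c.adj'
  have hww : w₂ ≠ w := by
    rintro rfl
    rcases c.nbr_right _ c₂.adj.symm with e | e | e | e
    · exact c₂.ne_p (by rw [e, h.ps])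
    · exact c₂.ne_s (by rw [e, h.sp])
    · exact hR (h.trans (h.step u) (e ▸ h.symm (h.trans (h.step v) (h.step _))))
    · exact hv e
  have hsu : s u ≠ w := c.adj'.ne
  have hRw : ¬ R (s u) w := fun h' => hR (h.trans (h.step u) (h.trans h' (h.symm c.rel)))
  have hlw := h.long_of_rel hv c.rel
  have hpu := h.two_inv hu
  have hsuu : G.Adj (s u) u := (h.adj u).symm
  have hpw : s u ≠ p (p w) := fun e => hRw (e ▸ h.symm (h.trans (h.step' w) (h.step' _)))
  have hRuw : ∀ x, R v x → u ≠ x := fun x hx e => hR (e ▸ h.symm hx)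
  have r2 : R v w₂ := h.trans (h.trans (h.step v) (h.step _)) c₂.rel
  have rpp : R v (p (p w)) := h.trans c.rel (h.trans (h.step' w) (h.step' _))
  have hwpp : w ≠ p (p w) := by have := h.sp w; have := h.sp (p w); grind
  -- the neighbourhood of the vertex between the two ends
  have hn1 : ∀ x, G.Adj (s v) x → R v x := by
    intro x hx
    have a1 : v ≠ p w := by rintro rfl; exact c.ne_s (h.sp w).symm
    have a2 : v ≠ s w₂ := by
      rintro rfl
      exact h.sp' _ _ hR huv (by rw [h.ps]; exact c₂.adj')
    have a3 : s (s v) ≠ p w := fun e => hw3 (by rw [e, h.sp])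
    have a4 : s (s v) ≠ s w₂ := fun e => c₂.ne_p (by rw [e, h.ps])
    have a5 : p w ≠ s w₂ := fun e => hw₂ (by rw [e, h.ps])
    have := h.four (s v) v (s (s v)) (p w) (s w₂) x hv.symm a1 a2 a3 a4 a5 (h.adj v).symm
      (h.adj _) c.adj_sp (by simpa [h.ps] using c₂.adj_ps) hx
    rcases this with rfl | rfl | rfl | rfl
    · exact h.equiv.refl _
    · exact h.trans (h.step v) (h.step _)
    · exact h.trans c.rel (h.step' _)
    · exact h.trans r2 (h.step _)
  obtain ⟨y, hyw, huy, hwy, hRy, hy1, hy2⟩ := h.inv.exists_next (u := s u) (v := w)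
    (by rw [h.ps, hpu.2]) hRw c.adj' (h.inv.long_of_rel (fun e => hv (h.inv.two_inv e).1) c.rel)
  have hy : y = p (p w) := by
    apply hy1
    by_contra hwy'
    have hyt := hy2 hwy'
    have hyt' : s (s y) = y := (h.inv.two_inv hyt).1
    have hRyw : ¬ R y (p w) := fun h' => hwy' (h.symm (h.trans h' (h.symm (h.step' w))))
    obtain ⟨r, d⟩ := h.exists_chord hyt' hRyw hwy.symm (h.long_of_rel hlw (h.step' w))
    rcases d.nbr_left _ c.adj_sp.symm with e | e | e | e
    · rw [h.sp] at e; exact c.ne_s e.symm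
    · exact hw3 (by rw [e, h.sp, h.sp])
    · exact hwy' (h.symm (h.trans (e ▸ h.symm (h.step v)) c.rel))
    · have := hn1 _ (e ▸ d.adj'.symm)
      exact hwy' (h.symm (h.trans (h.step y) (h.trans (h.symm this) c.rel)))
  subst hy
  have hnu : ∀ x, G.Adj (s u) x → x = u ∨ x = w ∨ x = w₂ ∨ x = p (p w) := fun x hx =>
    h.four (s u) u w w₂ (p (p w)) x (hRuw _ c.rel) (hRuw _ r2) (hRuw _ rpp) hww.symm hwpp hw₂
      hsuu c.adj' c₂.adj' huy hx
  have h4 : s (s (s (s w))) ≠ w := by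
    have := (c.swap h hu huv).not_four h
    exact this
  -- All neighbours of `s u` are known: the vertex after `w` must be `w₂ = s (s w)`, and the one
  -- after `w₂` would close the cycle after 4 or 6 steps.
  obtain ⟨y, hyw, huy', hwy', hRy', hy1', -⟩ := h.exists_next (u := s u) (v := w)
    (by rw [hu]) hRw c.adj' hlw
  have hRw₂ : ¬ R (s u) w₂ := fun h' => hR (h.trans (h.step u) (h.trans h' (h.symm r2)))
  have hlw₂ := h.long_of_rel hv r2
  have e1 : w₂ = s (s w) := by
    rcases hnu y huy' with e | e | e | e
    · exact absurd (e ▸ hwy'.symm) (hu ▸ h.ss _ _ hRw c.adj')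
    · exact absurd e hyw
    · rw [← e]; exact hy1' (h.trans (h.symm c.rel) (e ▸ r2))
    · have := hy1' (h.trans (h.symm c.rel) (e ▸ rpp))
      exact absurd (by rw [← this, e, h.sp, h.sp]) h4
  obtain ⟨t, htw, hut, hwt, -, ht1, -⟩ := h.exists_next (u := s u) (v := w₂)
    (by rw [hu]) hRw₂ c₂.adj' hlw₂
  rcases hnu t hut with e | e | e | e
  · exact absurd (e ▸ hwt.symm) (hu ▸ h.ss _ _ hRw₂ c₂.adj')
  · have := ht1 (h.trans (h.symm r2) (e ▸ c.rel))
    exact h4 (by rw [← e1, ← this, e])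
  · exact htw e
  · have := ht1 (h.trans (h.symm r2) (e ▸ rpp))
    have h6 : s (s (s (s (s (s w))))) = w := by
      rw [← e1, ← this, e, h.sp, h.sp]
    refine (c.swap h hu huv).not_six h ?_ h6
    rintro e'
    apply hw3
    rw [e', h6]

/-- Stepping outwards from `v` and from `s (s v)` both yield the only remaining neighbour `x` of
`u`. Were `x` on the cycle of `v`, it would be both `p (p v)` and `s (s (s (s v)))`, giving the
excluded length 6. -/
lemma exists_nested_fourth (h : G.Rotation s p R) {w₂ : V} (hu : s (s u) = u) (hR : ¬ R u v)
    (huv : G.Adj u v) (hv : s (s v) ≠ v) (huv₂ : G.Adj u (s (s v))) (c : Chord G s p R u v w)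
    (c₂ : Chord G s p R u (s (s v)) w₂) : ∃ x, G.Adj u x ∧ G.Adj (p v) x ∧
      G.Adj (s (s (s v))) x ∧ ¬ R u x ∧ ¬ R v x ∧ s (s x) = x := by
  have hvv₂ : R v (s (s v)) := h.trans (h.step v) (h.step _)
  have hR₂ : ¬ R u (s (s v)) := fun h' => hR (h.trans h' (h.symm hvv₂))
  have hw3 : w ≠ s (s (s v)) := by
    rintro rfl
    exact h.ss _ _ hR₂ huv₂ c.adj'
  have hv4 := c.not_four h
  have hne : s (s (s v)) ≠ p v := fun e => hv4 (by rw [e, h.sp])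
  have hRuw : ∀ x, R v x → u ≠ x := fun x hx e => hR (e ▸ h.symm hx)
  obtain ⟨x, hxv, hux, hvx, hRx, hx1, -⟩ := h.inv.exists_next (u := u) (v := v)
    (h.two_inv hu).1 hR huv (fun e => hv (h.inv.two_inv e).1)
  obtain ⟨x', hxv', hux', hvx', -, -, hx2'⟩ := h.exists_next hu hR₂ huv₂
    (h.long_of_rel hv hvv₂)
  have hx2 : x ≠ s (s v) := by
    rintro rfl
    rcases c₂.nbr_left _ hvx.symm with e | e | e | e
    · exact hne e.symm
    · rw [h.ps] at e
      exact hv (by rw [← e, h.sp])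
    · exact hRuw _ (h.step' v) e.symm
    · exact h.sp' _ _ hR huv (e ▸ c₂.adj')
  have hxv2 : x' ≠ v := by
    rintro rfl
    rcases c.nbr_left _ hvx'.symm with e | e | e | e
    · exact hv (by rw [← h.ps (s (s x')), e, h.ps])
    · exact hne e
    · exact hRuw _ (h.trans hvv₂ (h.step _)) e.symm
    · exact hw3 e.symm
  have hsu : ∀ y, ¬ R u y → s u ≠ y := fun y hy e => hy (e ▸ h.step u)
  have hxx : x' = x := by
    rcases h.four u (s u) v (s (s v)) x x' (hsu _ hR) (hsu _ hR₂) (hsu _ hRx) hv.symm hxv.symm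
      hx2.symm (h.adj u) huv huv₂ hux hux' with e | e | e | e
    · exact absurd (e ▸ hvx'.symm) (h.ss _ _ hR₂ huv₂)
    · exact absurd e hxv2
    · exact absurd e hxv'
    · exact e
  rw [hxx] at hvx' hx2'
  have hvx3 : ¬ R v x := by
    intro h'
    have e := hx1 h'
    have h'' : x = s (s (s (s v))) := by
      rcases h.exists_next hu hR₂ huv₂ (h.long_of_rel hv hvv₂) with ⟨x'', a1, a2, a3, -, a5, -⟩
      rcases h.four u (s u) v (s (s v)) x x'' (hsu _ hR) (hsu _ hR₂) (hsu _ hRx) hv.symm hxv.symm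
        hx2.symm (h.adj u) huv huv₂ hux a2 with e | e | e | e
      · exact absurd (e ▸ a3.symm) (h.ss _ _ hR₂ huv₂)
      · rw [e] at a3
        rcases c.nbr_left _ a3.symm with e | e | e | e
        · exact absurd (by rw [← h.ps (s (s v)), e, h.ps]) hv
        · exact absurd e hne
        · exact absurd e.symm (hRuw _ (h.trans hvv₂ (h.step _)))
        · exact absurd e.symm hw3
      · exact absurd e a1
      · rw [← e]; exact a5 (h.trans (h.symm hvv₂) (e ▸ h'))
    refine c.not_six h hw3 ?_
    rw [← h'', e, h.sp, h.sp]
  exact ⟨x, hux, hvx, hvx', hRx, hvx3, hx2' fun h' => hvx3 (h.trans hvv₂ h')⟩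

/-- The outer neighbours `x` of `u` and `y` of `s u` attach to the two ends of the next chord
inwards, `s (s (s v))`–`p w₂`. That chord then forces `y = s x`, and the edges `u x`, `s u`–`s x`
would merge two 2-cycles. -/
lemma not_adj_apply_apply (h : G.Rotation s p R) (hu : s (s u) = u) (hR : ¬ R u v)
    (huv : G.Adj u v) (hv : s (s v) ≠ v) : ¬ G.Adj u (s (s v)) := by
  intro huv₂
  have hvv₂ : R v (s (s v)) := h.trans (h.step v) (h.step _)
  have hR₂ : ¬ R u (s (s v)) := fun h' => hR (h.trans h' (h.symm hvv₂))
  obtain ⟨w, c⟩ := h.exists_chord hu hR huv hv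
  obtain ⟨w₂, c₂⟩ := h.exists_chord hu hR₂ huv₂ (h.long_of_rel hv hvv₂)
  by_cases hw₂ : w₂ ≠ p (p w)
  · exact h.false_of_not_nested hu hR huv hv huv₂ c c₂ hw₂
  rw [not_not] at hw₂
  have hRuw : ∀ x, R v x → u ≠ x := fun x hx e => hR (e ▸ h.symm hx)
  obtain ⟨x, hux, hpx, hsx, hRx, hvx, hx⟩ := h.exists_nested_fourth hu hR huv hv huv₂ c c₂
  have hpu := h.two_inv hu
  have hsu := h.two_inv (u := s u) (by rw [hu])
  have hRw : ¬ R (s u) w := fun h' => hR (h.trans (h.step u) (h.trans h' (h.symm c.rel)))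
  have d := (c.swap h hu huv).inv h (by rw [hu])
  have d₂ := (c₂.swap h hu huv₂).inv h (by rw [hu])
  have ev : v = p (p (s (s v))) := by rw [h.ps, h.ps]
  obtain ⟨y, huy, -, hsy, hRy, hwy, -⟩ := h.inv.exists_nested_fourth hsu.1 hRw c.adj'
    (fun e => h.long_of_rel hv c.rel (h.inv.two_inv e).1) (hw₂ ▸ c₂.adj') d (hw₂ ▸ d₂)
  rw [← hw₂] at hsy
  have hv3 : R v (s (s (s v))) := h.trans hvv₂ (h.step _)
  have hRx3 : ¬ R x (s (s (s v))) := fun h' => hvx (h.trans hv3 (h.symm h'))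
  obtain ⟨w₃, c₃⟩ := h.exists_chord hx hRx3 hsx.symm (h.long_of_rel hv hv3)
  have r3 : R v w₃ := h.trans hv3 c₃.rel
  have e3 : w₃ = p w₂ := by
    have := c₃.adj_ps
    rw [h.ps] at this
    rcases c₂.nbr_left _ this with e | e | e | e
    · exact absurd (by rw [← h.ps w₃, e]) c₃.ne_p
    · rw [h.ps] at e
      have e : w₃ = v := by rw [← h.ps w₃, e, h.ps]
      have hxv := e ▸ c₃.adj'
      have hxn : ∀ z, R v z → s x ≠ z := fun z hz e =>
        hvx (h.trans hz (e ▸ h.symm (h.step x)))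
      rcases c.nbr_left _ hxv.symm with e | e | e | e
      · exact absurd e (hxn _ (h.step v))
      · exact absurd e (hxn _ (h.step' v))
      · exact absurd (e ▸ h.symm (h.step x)) hRx
      · exact absurd e (hxn _ c.rel)
    · exact absurd e.symm (hRuw _ (h.trans r3 (h.step _)))
    · rw [← e, h.ps]
  have hyn : ∀ z, R v z → y ≠ z := fun z hz e => hwy (h.trans (h.symm c.rel) (e ▸ hz))
  rcases c₃.nbr_right _ (e3 ▸ hsy) with e | e | e | e
  · exact hyn _ (h.trans r3 (h.step _)) e
  · exact hyn _ (h.trans r3 (h.step' _)) e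
  · exact h.ss _ _ hRx hux (e ▸ huy)
  · exact hyn _ hv3 e

lemma exists_third (h : G.Rotation s p R) (hu : s (s u) = u) (hR : ¬ R u v) (huv : G.Adj u v)
    (hv : s (s v) ≠ v) : ∃ z, G.Adj u z ∧ G.Adj (s v) z ∧ ¬ R u z ∧ ¬ R v z ∧ s (s z) = z := by
  obtain ⟨z, -, huz, hvz, hRz, h1, h2⟩ := h.exists_next hu hR huv hv
  have : ¬ R v z := fun h' => h.not_adj_apply_apply hu hR huv hv (h1 h' ▸ huz)
  exact ⟨z, huz, hvz, hRz, this, h2 this⟩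

/-- `s v` meets a third cycle at `z` and has a chord to `q`. If its neighbour `p w` were `q`, the
outside neighbour `y` of `p w` would be `s z`, so that `u z` and `s u`–`s z` would merge two
2-cycles. -/
lemma Chord.eq_apply_apply (h : G.Rotation s p R) (hu : s (s u) = u) (hR : ¬ R u v)
    (huv : G.Adj u v) (hv : s (s v) ≠ v) (c : Chord G s p R u v w) : w = s (s (s v)) := by
  obtain ⟨z, huz, hvz, hRz, hRvz, hz⟩ := h.exists_third hu hR huv hv
  have hRzv : ¬ R z (s v) := fun h' => hRvz (h.trans (h.step v) (h.symm h'))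
  obtain ⟨q, d⟩ := h.exists_chord hz hRzv hvz.symm (h.long_of_rel hv (h.step v))
  have hRw : ¬ R (s u) w := fun h' => hR (h.trans (h.step u) (h.trans h' (h.symm c.rel)))
  have hsu := h.two_inv (u := s u) (by rw [hu])
  obtain ⟨y, huy, hwy, hRy, hRwy, -⟩ := h.inv.exists_third hsu.1 hRw c.adj'
    (fun e => h.long_of_rel hv c.rel (h.inv.two_inv e).1)
  rcases d.nbr_left _ c.adj_sp with e | e | e | e
  · rw [← e, h.sp]
  · rw [h.ps] at e
    exact absurd (by rw [← e, h.sp]) c.ne_s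
  · exact absurd (e ▸ h.trans c.rel (h.step' w)) hRvz
  · have hyn : ∀ z, R v z → y ≠ z := fun z hz e => hRwy (h.trans (h.symm c.rel) (e ▸ hz))
    have hq : R v q := h.trans (h.step v) d.rel
    rcases d.nbr_right _ (e ▸ hwy) with e | e | e | e
    · exact absurd e (hyn _ (h.trans hq (h.step _)))
    · exact absurd e (hyn _ (h.trans hq (h.step' _)))
    · exact absurd (e ▸ huy) (h.ss _ _ hRz huz)
    · exact absurd e (hyn _ (h.step v))

/-- A 2-cycle and a long cycle are not joined by an edge. -/
lemma not_adj_of_two_of_long (h : G.Rotation s p R) (hu : s (s u) = u) (hR : ¬ R u v)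
    (hv : s (s v) ≠ v) : ¬ G.Adj u v := by
  intro huv
  obtain ⟨w, c⟩ := h.exists_chord hu hR huv hv
  obtain ⟨z, huz, hvz, hRz, hRvz, hz⟩ := h.exists_third hu hR huv hv
  have hRzv : ¬ R z (s v) := fun h' => hRvz (h.trans (h.step v) (h.symm h'))
  have hl := h.long_of_rel hv (h.step v)
  obtain ⟨q, d⟩ := h.exists_chord hz hRzv hvz.symm hl
  have e1 := c.eq_apply_apply h hu hR huv hv
  have e2 := d.eq_apply_apply h hz hRzv hvz.symm hl
  -- Both chords span three steps, so `q = s w`. The outside neighbour `y` of `s w` given by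
  -- `exists_third` is then `s z`, which permits a merge with `u z`.
  rw [← e1] at e2
  have hRw : ¬ R (s u) w := fun h' => hR (h.trans (h.step u) (h.trans h' (h.symm c.rel)))
  obtain ⟨y, huy, hwy, hRy, hRwy, -⟩ := h.exists_third (u := s u) (by rw [hu]) hRw c.adj'
    (h.long_of_rel hv c.rel)
  have hyn : ∀ z, R v z → y ≠ z := fun z hz e => hRwy (h.trans (h.symm c.rel) (e ▸ hz))
  have hq : R v q := h.trans (h.step v) d.rel
  rcases d.nbr_right _ (e2 ▸ hwy) with e | e | e | e
  · exact absurd e (hyn _ (h.trans hq (h.step _)))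
  · exact absurd e (hyn _ (h.trans hq (h.step' _)))
  · exact absurd (e ▸ huy) (h.ss _ _ hRz huz)
  · exact absurd e (hyn _ (h.step v))

end Rotation
end SimpleGraph

/-! ### Existence of adjacency permutations. -/

namespace SimpleGraph

variable {V : Type*} [Fintype V] [DecidableEq V] {G : SimpleGraph V} {σ τ : Equiv.Perm V}

omit [Fintype V] [DecidableEq V] in
lemma IsSQuadrangular.card_le_card (h : G.IsSQuadrangular) {S T : Finset V}
    (hS : S.Nontrivial) (hq : ∀ u ∈ S, ∃ v ∈ S, v ≠ u ∧ ∃ w, G.Adj u w ∧ G.Adj v w)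
    (hT : ∀ u ∈ S, ∀ v ∈ S, u ≠ v → ∀ w, G.Adj u w → G.Adj v w → w ∈ T) :
    S.card ≤ T.card := by
  have key := h.1 (S : Set V) ⟨hS, fun u hu => hq u hu⟩
  rw [Set.ncard_coe_finset] at key
  refine key.trans ?_
  rw [← Set.ncard_coe_finset T]
  refine Set.ncard_le_ncard ?_ T.finite_toSet
  rintro w ⟨u, hu, v, hv, huv, hw1, hw2⟩
  exact hT u hu v hv huv w hw1 hw2

omit [Fintype V] in
lemma IsSQuadrangular.exists_common (h : G.IsSQuadrangular) {a b c : V} (hab : a ≠ b)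
    (hac : G.Adj a c) (hbc : G.Adj b c) : ∃ d, d ≠ c ∧ G.Adj a d ∧ G.Adj b d := by
  by_contra! hcon
  have := h.card_le_card (S := {a, b}) (T := {c})
    ⟨a, by simp, b, by simp, hab⟩ (by
    intro u hu
    simp only [Finset.mem_insert, Finset.mem_singleton] at hu
    rcases hu with rfl | rfl
    · exact ⟨b, by simp, hab.symm, c, hac, hbc⟩
    · exact ⟨a, by simp, hab, c, hbc, hac⟩) (by
    intro u hu v hv huv w hw1 hw2
    simp only [Finset.mem_insert, Finset.mem_singleton] at hu hv ⊢
    by_contra hw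
    rcases hu with rfl | rfl <;> rcases hv with rfl | rfl
    · exact huv rfl
    · exact hcon w hw hw1 hw2
    · exact hcon w hw hw2 hw1
    · exact huv rfl)
  rw [Finset.card_pair hab, Finset.card_singleton] at this
  omega

/-- An s-quadrangular graph without isolated vertices has a cycle factor (an adjacency
permutation), by Hall's theorem. -/
lemma IsSQuadrangular.exists_isAdjPerm [DecidableRel G.Adj] (h : G.IsSQuadrangular) {f : V → V}
    (hf : ∀ v, G.Adj v (f v)) : ∃ σ, G.IsAdjPerm σ := by
  have hall : ∀ S : Finset V, S.card ≤ (S.biUnion fun v => G.neighborFinset v).card := by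
    intro S
    -- Vertices of `S` sharing a neighbour with another vertex of `S` form a q-set or the empty set.
    -- The others have private neighbours, so `f` is injective on them and avoids the common
    -- neighbours.
    let Q : V → Prop := fun u => ∃ v ∈ S, v ≠ u ∧ ∃ w, G.Adj u w ∧ G.Adj v w
    classical
    let S₁ := S.filter Q
    let S₀ := S.filter fun u => ¬ Q u
    let T₁ : Finset V := (S.biUnion fun v => G.neighborFinset v).filter
      fun w => ∃ u ∈ S, ∃ v ∈ S, u ≠ v ∧ G.Adj u w ∧ G.Adj v w
    have h1 : S₁.card ≤ T₁.card := by
      rcases S₁.eq_empty_or_nonempty with e | ⟨u, hu⟩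
      · simp [e]
      have hq : ∀ u ∈ S₁, ∃ v ∈ S₁, v ≠ u ∧ ∃ w, G.Adj u w ∧ G.Adj v w := by
        intro u hu
        obtain ⟨huS, v, hv, hvu, w, hw1, hw2⟩ := Finset.mem_filter.1 hu
        exact ⟨v, Finset.mem_filter.2 ⟨hv, u, huS, hvu.symm, w, hw2, hw1⟩, hvu, w, hw1, hw2⟩
      refine h.card_le_card ?_ hq ?_
      · obtain ⟨v, hv, hvu, -⟩ := hq u hu
        exact ⟨v, hv, u, hu, hvu⟩
      · intro u hu v hv huv w hw1 hw2
        have hu := (Finset.mem_filter.1 hu).1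
        have hv := (Finset.mem_filter.1 hv).1
        refine Finset.mem_filter.2 ⟨?_, u, hu, v, hv, huv, hw1, hw2⟩
        exact Finset.mem_biUnion.2 ⟨u, hu, by simpa using hw1⟩
    have h0 : (S₀.image f).card = S₀.card := by
      refine Finset.card_image_of_injOn fun u hu v hv huv => ?_
      obtain ⟨hu, hu'⟩ := Finset.mem_filter.1 hu
      obtain ⟨hv, -⟩ := Finset.mem_filter.1 hv
      by_contra hne
      exact hu' ⟨v, hv, fun e => hne e.symm, f u, hf u, by
        have := hf v; rwa [← show f u = f v from huv] at this⟩
    have hd : Disjoint (S₀.image f) T₁ := by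
      rw [Finset.disjoint_left]
      intro w hw hw'
      obtain ⟨u, hu, rfl⟩ := Finset.mem_image.1 hw
      obtain ⟨hu, hu'⟩ := Finset.mem_filter.1 hu
      obtain ⟨-, a, ha, b, hb, hab, h1, h2⟩ := Finset.mem_filter.1 hw'
      by_cases hau : a = u
      · exact hu' ⟨b, hb, fun e => hab (hau.trans e.symm), f u, hf u, h2⟩
      · exact hu' ⟨a, ha, hau, f u, hf u, h1⟩
    calc S.card = S₁.card + S₀.card := (Finset.card_filter_add_card_filter_not Q).symm
      _ ≤ T₁.card + (S₀.image f).card := by omega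
      _ = (S₀.image f ∪ T₁).card := by rw [Finset.card_union_of_disjoint hd, add_comm]
      _ ≤ _ := Finset.card_le_card (by
        refine Finset.union_subset (fun w hw => ?_) (Finset.filter_subset _ _)
        obtain ⟨u, hu, rfl⟩ := Finset.mem_image.1 hw
        exact Finset.mem_biUnion.2 ⟨u, (Finset.mem_filter.1 hu).1, by simpa using hf u⟩)
  obtain ⟨g, hg, hg'⟩ := (Finset.all_card_le_biUnion_card_iff_exists_injective _).1 hall
  exact ⟨Equiv.ofBijective g (Finite.injective_iff_bijective.1 hg), fun v => by
    simpa using hg' v⟩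

omit [DecidableEq V] in
-- The map `σ⁻¹ ∘ f` permutes its periodic points; replacing `σ` by `f` on these keeps a
-- permutation.
lemma IsAdjPerm.exists_ne [Nonempty V] (h : G.IsAdjPerm σ) {f : V → V}
    (hf : ∀ v, G.Adj v (f v)) (hne : ∀ v, f v ≠ σ v) : ∃ τ, G.IsAdjPerm τ ∧ τ ≠ σ := by
  classical
  let g : V → V := fun x => σ⁻¹ (f x)
  have hg : ∀ x, σ (g x) = f x := fun x => by simp [g]
  let P := Function.periodicPts g
  have hP : Set.BijOn g P P := Function.bijOn_periodicPts g
  obtain ⟨x₀⟩ := ‹Nonempty V›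
  obtain ⟨a, ha⟩ : ∃ a, a ∈ P := by
    obtain ⟨m, n, hmn, he⟩ := Finite.exists_ne_map_eq_of_infinite fun n : ℕ => g^[n] x₀
    wlog hlt : m < n generalizing m n
    · exact this n m hmn.symm he.symm (by omega)
    refine ⟨g^[m] x₀, n - m, by omega, ?_⟩
    change g^[n - m] (g^[m] x₀) = _
    rw [← Function.iterate_add_apply, Nat.sub_add_cancel hlt.le]
    exact he.symm
  let t : V → V := fun x => if x ∈ P then f x else σ x
  have ht : Function.Injective t := by
    intro x y hxy
    simp only [t] at hxy
    split_ifs at hxy with hx hy hy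
    · exact hP.injOn hx hy (by simp only [g, hxy])
    · rw [← hg, σ.apply_eq_iff_eq] at hxy
      exact absurd (hxy ▸ hP.mapsTo hx) hy
    · rw [← hg y, σ.apply_eq_iff_eq] at hxy
      exact absurd (hxy ▸ hP.mapsTo hy) hx
    · exact σ.injective hxy
  refine ⟨Equiv.ofBijective t (Finite.injective_iff_bijective.1 ht), fun v => ?_, fun e => ?_⟩
  · simp only [Equiv.ofBijective_apply, t]
    split_ifs
    exacts [hf v, h v]
  · have := congrArg (· a) e
    simp only [Equiv.ofBijective_apply, t, if_pos ha] at this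
    exact hne a this

omit [DecidableEq V] in
/-- Two distinct perfect matchings can be mixed to an adjacency permutation that is not an
involution. -/
lemma IsAdjPerm.exists_not_involutive (hσ : G.IsAdjPerm σ) (hτ : G.IsAdjPerm τ) (hne : τ ≠ σ) :
    ∃ ρ, G.IsAdjPerm ρ ∧ ∃ a, ρ (ρ a) ≠ a := by
  classical
  by_cases h1 : ∃ a, σ (σ a) ≠ a
  · exact ⟨σ, hσ, h1⟩
  by_cases h2 : ∃ a, τ (τ a) ≠ a
  · exact ⟨τ, hτ, h2⟩
  push Not at h1 h2
  obtain ⟨x, hx⟩ : ∃ x, τ x ≠ σ x := by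
    by_contra! hcon
    exact hne (Equiv.ext hcon)
  -- In the alternating cycle of the two matchings through `x`, `A` holds at every second vertex. It
  -- misses `σ x`: as `σ` conjugates `τ * σ` to its inverse, otherwise `σ` or `τ` would fix a
  -- vertex.
  let A : V → Prop := fun y => (τ * σ).SameCycle x y
  have hA : ∀ y, A y → A (τ (σ y)) := fun y hy => by
    have : (τ * σ).SameCycle x ((τ * σ) y) := Equiv.Perm.sameCycle_apply_right.2 hy
    exact this
  have hconj : ∀ (n : ℤ) y, σ (((τ * σ) ^ n) y) = ((τ * σ) ^ (-n)) (σ y) := by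
    have hs : SemiconjBy σ (τ * σ) (τ * σ)⁻¹ := by
      rw [SemiconjBy, eq_inv_mul_iff_mul_eq]
      ext y
      simp [h1, h2]
    intro n y
    have := (hs.zpow_right n).eq
    rw [inv_zpow'] at this
    exact DFunLike.congr_fun this y
  have hxA : ¬ A (σ x) := by
    rintro ⟨n, hn⟩
    rcases Int.even_or_odd' n with ⟨k, rfl | rfl⟩
    · have e := hconj k x
      have e' : (τ * σ) ^ k = (τ * σ) ^ (-k) * (τ * σ) ^ (2 * k) := by rw [← zpow_add]; congr 1; ring
      rw [← hn, ← Equiv.Perm.mul_apply _ ((τ * σ) ^ (2 * k)), ← e'] at e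
      exact (hσ _).ne e.symm
    · have e := hconj k x
      have e' : τ * σ * (τ * σ) ^ k = (τ * σ) ^ (-k) * (τ * σ) ^ (2 * k + 1) := by
        rw [← zpow_add, ← zpow_one_add]; congr 1; ring
      rw [← hn, ← Equiv.Perm.mul_apply _ ((τ * σ) ^ (2 * k + 1)), ← e'] at e
      exact (hτ _).ne e
  -- Travel round that alternating cycle, leaving `A` by `σ` and returning by `τ`; keep `σ`
  -- elsewhere.
  let t : V → V := fun y => if A (σ y) then τ y else σ y
  have ht : Function.Injective t := by
    have aux : ∀ y z, A (σ y) → τ y = σ z → A (σ z) := by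
      intro y z hy e
      have := hA _ hy
      rwa [h1, e] at this
    intro y z hyz
    simp only [t] at hyz
    split_ifs at hyz with hy hz hz
    · exact τ.injective hyz
    · exact absurd (aux y z hy hyz) hz
    · exact absurd (aux z y hz hyz.symm) hy
    · exact σ.injective hyz
  refine ⟨Equiv.ofBijective t (Finite.injective_iff_bijective.1 ht), fun v => ?_, x, ?_⟩
  · simp only [Equiv.ofBijective_apply, t]
    split_ifs
    exacts [hτ v, hσ v]
  · have hx' : A (σ (σ x)) := by rw [h1]
    simp only [Equiv.ofBijective_apply, t, if_neg hxA, if_pos hx']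
    intro e
    exact hx (by rw [← e, h2, e])

lemma IsCoarsest.rotation [DecidableRel G.Adj] (h : G.IsCoarsest σ) (hsq : G.IsSQuadrangular)
    (hdeg : ∀ v, G.degree v ≤ 4) : G.Rotation σ (σ⁻¹ : Equiv.Perm V) σ.SameCycle where
  sp x := by simp
  ps x := by simp
  adj := h.adj
  equiv := Equiv.Perm.SameCycle.equivalence σ
  step x := by simp [Equiv.Perm.SameCycle.refl]
  iter x y hxy := by
    obtain ⟨n, rfl⟩ := hxy.exists_nat_pow_eq
    exact ⟨n, by rw [Equiv.Perm.iterate_eq_pow]⟩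
  ss _ _ := h.not_adj_apply_apply
  sp' _ _ := h.not_adj_apply_inv
  pp _ _ := h.not_adj_inv_inv
  chord_s _ _ _ := h.not_adj_of_chord
  chord_p _ _ _ hu hR huv hw hvw hs := h.inv.not_adj_of_chord hu (by simpa using hR) huv hw hvw
    (by simpa using hs)
  quad _ _ _ := hsq.exists_common
  four v a b c d x hab hac had hbc hbd hcd ha hb hc hd hx := by
    by_contra! hcon
    have hsub : ({x, a, b, c, d} : Finset V) ⊆ G.neighborFinset v := by
      intro y hy
      simp only [Finset.mem_insert, Finset.mem_singleton] at hy
      rw [mem_neighborFinset]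
      rcases hy with rfl | rfl | rfl | rfl | rfl <;> assumption
    have hcard := (Finset.card_le_card hsub).trans (hdeg v)
    have : ({x, a, b, c, d} : Finset V).card = 5 := by
      rw [Finset.card_insert_of_notMem, Finset.card_insert_of_notMem,
        Finset.card_insert_of_notMem, Finset.card_insert_of_notMem, Finset.card_singleton] <;>
      simp [*]
    omega

omit [Fintype V] [DecidableEq V] in
lemma Connected.induction (h : G.Connected) {P : V → Prop} {a : V} (ha : P a)
    (hstep : ∀ x y, G.Adj x y → P x → P y) (b : V) : P b := by
  obtain ⟨p⟩ := h a b
  induction p with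
  | nil => exact ha
  | cons hxy _ ih => exact ih (hstep _ _ hxy ha)

/-- If `a` were the only neighbour of `x`, any other neighbour of `a` would share a second neighbour
with `x`. So the graph would consist of `x` and `a`. -/
lemma IsSQuadrangular.exists_adj_ne (hsq : G.IsSQuadrangular) (hconn : G.Connected)
    (hcard : 3 ≤ Fintype.card V) (x a : V) : ∃ b, G.Adj x b ∧ b ≠ a := by
  by_contra! hcon
  have : ∀ y, y = x ∨ y = a := by
    have : Nontrivial V := Fintype.one_lt_card_iff_nontrivial.1 (by omega)
    obtain ⟨c, hc⟩ := hconn.preconnected.exists_adj_of_nontrivial x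
    obtain rfl := hcon c hc
    refine hconn.induction (a := x) (.inl rfl) ?_
    rintro y z hyz (rfl | rfl)
    · exact .inr (hcon z hyz)
    · by_contra! hz
      obtain ⟨d, hd, hxd, -⟩ := hsq.exists_common hz.1.symm hc hyz.symm
      exact hd (hcon d hxd)
  have hsub : (Finset.univ : Finset V) ⊆ {x, a} := fun y _ => by simpa using this y
  have := (Finset.card_le_card hsub).trans Finset.card_le_two
  rw [Finset.card_univ] at this
  omega

/-! ### Factors with long cycles only. -/

/-- Each cycle is entered at `σ (g^[i] x)`, traversed completely to `g^[i] x`, and left for the next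
entry point. -/
lemma IsCoarsest.exists_traces (h : G.IsCoarsest σ) {g : V → V}
    (hg : ∀ x, G.Adj x (σ (g x))) (x : V) (n : ℕ)
    (hD : ∀ i j, i < j → j ≤ n → ¬ σ.SameCycle (g^[i] x) (g^[j] x)) :
    ∃ l, G.Traces l (σ x) (g^[n] x) ∧ l.Nodup ∧
      ∀ z, z ∈ l ↔ ∃ k ≤ n, σ.SameCycle (g^[k] x) z := by
  have base : ∀ y, G.Traces (σ.toList (σ y)) (σ y) y := fun y => by
    simpa using h.adj.traces_toList (σ y)
  induction n with
  | zero => exact ⟨_, base x, σ.nodup_toList _, fun z => by simp [h.adj.mem_toList]⟩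
  | succ n ih =>
    obtain ⟨l, hl, hn, hm⟩ := ih fun i j hij hj => hD i j hij (hj.trans n.le_succ)
    refine ⟨l ++ σ.toList (σ (g^[n + 1] x)), hl.append (base _) ?_,
      List.Nodup.append hn (σ.nodup_toList _) ?_, fun z => ?_⟩
    · rw [Function.iterate_succ_apply']
      exact hg _
    · intro z hz hz'
      obtain ⟨k, hk, hkz⟩ := (hm z).1 hz
      rw [h.adj.mem_toList, Equiv.Perm.sameCycle_apply_left] at hz'
      exact hD k (n + 1) (by omega) le_rfl (hkz.trans hz'.symm)
    · rw [List.mem_append, hm, h.adj.mem_toList, Equiv.Perm.sameCycle_apply_left]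
      constructor
      · rintro (⟨k, hk, hkz⟩ | hz)
        · exact ⟨k, by omega, hkz⟩
        · exact ⟨n + 1, le_rfl, hz⟩
      · rintro ⟨k, hk, hkz⟩
        rcases Nat.lt_or_ge n k with hk' | hk'
        · obtain rfl : k = n + 1 := by omega
          exact .inr hkz
        · exact .inl ⟨k, hk', hkz⟩

/-- In a coarsest permutation with long cycles, some vertex has no neighbour outside its cycle. -/
lemma IsCoarsest.exists_forall_sameCycle [Nonempty V] (h : G.IsCoarsest σ)
    (rot : G.Rotation σ (σ⁻¹ : Equiv.Perm V) σ.SameCycle) (hlong : ∀ x, σ (σ x) ≠ x) :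
    ∃ x, ∀ y, G.Adj x y → σ.SameCycle x y := by
  by_contra! hcon
  choose c hc hcD using hcon
  let g : V → V := fun x => σ⁻¹ (c x)
  have hσg : ∀ x, σ (g x) = c x := fun x => by simp [g]
  have hgD : ∀ x, ¬ σ.SameCycle x (g x) := fun x => by simpa [g] using hcD x
  have h4 : ∀ x, σ (σ (σ (σ x))) = x := fun x =>
    (rot.long_long (hcD x) (hc x) (hlong _) (hlong _)).1
  -- A shortest return to an earlier cycle makes all intermediate cycles distinct.
  have hex : ∃ d, 0 < d ∧ ∃ x, σ.SameCycle x (g^[d] x) := by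
    obtain ⟨x₀⟩ := ‹Nonempty V›
    obtain ⟨m, n, hmn, he⟩ := Finite.exists_ne_map_eq_of_infinite fun n : ℕ => g^[n] x₀
    wlog hlt : m < n generalizing m n
    · exact this n m hmn.symm he.symm (by omega)
    refine ⟨n - m, by omega, g^[m] x₀, ?_⟩
    rw [← Function.iterate_add_apply, Nat.sub_add_cancel hlt.le, show g^[n] x₀ = g^[m] x₀ from he.symm]
  classical
  obtain ⟨hd0, x, hx⟩ := Nat.find_spec hex
  have hmin : ∀ d', 0 < d' → d' < Nat.find hex → ∀ y, ¬ σ.SameCycle y (g^[d'] y) :=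
    fun d' h0 hd' y hy => Nat.find_min hex hd' ⟨h0, y, hy⟩
  generalize Nat.find hex = d at hd0 hx hmin
  obtain ⟨d, rfl⟩ : ∃ e, d = e + 1 := ⟨d - 1, by omega⟩
  have hd1 : 0 < d := by
    rcases Nat.eq_zero_or_pos d with rfl | h0
    · exact absurd hx (hgD x)
    · exact h0
  have hD : ∀ i j, i < j → j ≤ d → ¬ σ.SameCycle (g^[i] x) (g^[j] x) := by
    intro i j hij hj
    have := hmin (j - i) (by omega) (by omega) (g^[i] x)
    rwa [← Function.iterate_add_apply, Nat.sub_add_cancel hij.le] at this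
  set q := g^[d] x with hq
  have hqx : ¬ σ.SameCycle x q := hD 0 d hd1 le_rfl
  have hcq : c q = σ (g^[d + 1] x) := by rw [Function.iterate_succ_apply', hσg]
  have hq2 : G.Adj (σ (σ (c q))) q :=
    (rot.long_long (rot.not_symm (hcD q)) (hc q).symm (hlong _) (hlong _)).2.1
  -- The return may hit any of the four vertices of the cycle of `x`, but antipodal attachment lets
  -- `q` reach `x` or `σ x`. Reaching `x` would put `q` on the cycle of `g x`, against minimality,
  -- or for `d = 1` against `c x = σ (g x)`.
  have hclose : G.Adj q (σ x) := by
    have hbad : ¬ G.Adj q x := by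
      intro ha
      have hn := (rot.long_long (rot.not_symm (hcD x)) (hc x).symm (hlong _) (hlong _)).2.2
      have hgc : σ.SameCycle (g x) (c x) := by rw [← hσg]; simp [Equiv.Perm.SameCycle.refl]
      have key : σ.SameCycle (g x) q := by
        rcases hn q ha.symm with e | e | e | e
        · exact absurd (e ▸ rot.step x) hqx
        · exact absurd (e ▸ rot.step' x) hqx
        · rwa [e]
        · rw [e]; simpa using hgc
      obtain ⟨d, rfl⟩ : ∃ e, d = e + 1 := ⟨d - 1, by omega⟩
      rcases Nat.eq_zero_or_pos d with rfl | h0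
      · have hqg : q = g x := rfl
        rcases hn q ha.symm with e | e | e | e
        · exact hqx (e ▸ rot.step x)
        · exact hqx (e ▸ rot.step' x)
        · rw [hqg, ← hσg] at e
          exact h.adj.apply_ne _ e.symm
        · rw [hqg, ← hσg] at e
          have := h4 (g x)
          rw [← e] at this
          exact h.adj.apply_ne _ this
      · exact hmin d h0 (by omega) (g x) (by rwa [hq, Function.iterate_succ_apply] at key)
    rcases rot.eq_or_of_four (h4 x) hx with e | e | e | e
    · rw [e] at hcq; exact hcq ▸ hc q
    · rw [hcq, e, h4] at hq2
      exact absurd hq2.symm hbad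
    · rw [hcq, e, h4] at hq2
      exact hq2.symm
    · rw [e, h4] at hcq
      exact absurd (hcq ▸ hc q) hbad
  obtain ⟨l, hl, hn, hm⟩ := h.exists_traces (fun y => (hσg y).symm ▸ hc y) x d hD
  exact hqx (h.sameCycle_of_traces hl hn hclose (fun z => by simp [hm])
    ((hm _).2 ⟨0, by omega, .refl _ _⟩) ((hm _).2 ⟨d, le_rfl, .refl _ _⟩))

omit [Fintype V] in
/-- Having a neighbour on another cycle is inherited along a long cycle. -/
lemma IsSQuadrangular.exists_adj_apply (hsq : G.IsSQuadrangular)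
    (rot : G.Rotation σ (σ⁻¹ : Equiv.Perm V) σ.SameCycle) (hlong : ∀ x, σ (σ x) ≠ x) {u : V}
    (hu : ∃ v, G.Adj u v ∧ ¬ σ.SameCycle u v) :
    ∃ v, G.Adj (σ u) v ∧ ¬ σ.SameCycle (σ u) v := by
  obtain ⟨v, huv, hD⟩ := hu
  obtain ⟨h4, -, hnv⟩ := rot.long_long hD huv (hlong _) (hlong _)
  have hp : σ⁻¹ u = σ (σ (σ u)) := by
    rw [Equiv.Perm.inv_eq_iff_eq, h4]
  by_contra! hcon
  have hc : ∀ w, G.Adj (σ u) w → w = u ∨ w = σ u ∨ w = σ (σ u) ∨ w = σ (σ (σ u)) := fun w hw =>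
    rot.eq_or_of_four h4 (by simpa using hcon w hw)
  have h1 : σ u ≠ v := fun e => hD (e ▸ rot.step u)
  have h3 : σ (σ (σ u)) ≠ v := fun e => hD (by rw [← e]; simp [Equiv.Perm.SameCycle.refl])
  have h13 : σ u ≠ σ (σ (σ u)) := fun e => hlong u (σ.injective e).symm
  have a3 : G.Adj (σ (σ (σ u))) u := by
    have := rot.adj (σ (σ (σ u)))
    rwa [h4] at this
  have n1 : ∀ w, G.Adj (σ u) w → G.Adj v w → w = u ∨ w = σ (σ u) := by
    intro w hw hvw
    rcases hnv w hvw with rfl | rfl | h' | h'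
    · exact absurd hw (rot.ss _ _ hD huv)
    · exact absurd hw (rot.sp' _ _ hD huv)
    · exact .inl h'
    · exact .inr h'
  have n3 : ∀ w, G.Adj (σ (σ (σ u))) w → G.Adj v w → w = u ∨ w = σ (σ u) := by
    intro w hw hvw
    rw [← hp] at hw
    rcases hnv w hvw with rfl | rfl | h' | h'
    · exact absurd hw (rot.ps' _ _ hD huv)
    · exact absurd hw (rot.pp _ _ hD huv)
    · exact .inl h'
    · exact .inr h'
  have n13 : ∀ w, G.Adj (σ u) w → G.Adj (σ (σ (σ u))) w → w = u ∨ w = σ (σ u) := by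
    intro w hw hw'
    rcases hc w hw with rfl | rfl | rfl | rfl
    · exact .inl rfl
    · exact absurd hw (G.irrefl)
    · exact .inr rfl
    · exact absurd hw' (G.irrefl)
  -- A q-set of three vertices whose pairwise common neighbours are only `u` and its antipode.
  have := hsq.card_le_card (S := {σ u, σ (σ (σ u)), v}) (T := {u, σ (σ u)})
    ⟨σ u, by simp, v, by simp, h1⟩ (by
      intro a ha
      simp only [Finset.mem_insert, Finset.mem_singleton] at ha
      rcases ha with rfl | rfl | rfl
      · exact ⟨v, by simp, h1.symm, u, (rot.adj u).symm, huv.symm⟩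
      · exact ⟨v, by simp, h3.symm, u, a3, huv.symm⟩
      · exact ⟨σ u, by simp, h1, u, huv.symm, (rot.adj u).symm⟩) (by
      intro a ha b hb hab w haw hbw
      simp only [Finset.mem_insert, Finset.mem_singleton] at ha hb ⊢
      rcases ha with rfl | rfl | rfl <;> rcases hb with rfl | rfl | rfl
      exacts [absurd rfl hab, n13 w haw hbw, n1 w haw hbw, n13 w hbw haw, absurd rfl hab,
        n3 w haw hbw, n1 w hbw haw, n3 w hbw haw, absurd rfl hab])
  rw [Finset.card_eq_three.2 ⟨_, _, _, h13, h1, h3, rfl⟩] at this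
  have := this.trans Finset.card_le_two
  omega

end SimpleGraph

open SimpleGraph in
theorem theorem3p4 {V : Type*} [Fintype V] [DecidableEq V] (G : SimpleGraph V)
    [DecidableRel G.Adj] (hcard : 3 ≤ Fintype.card V) (hconn : G.Connected)
    (hsq : G.IsSQuadrangular) (hdeg : ∀ v : V, G.degree v ≤ 4) :
    G.IsHamiltonian := by
  have hne : Nonempty V := hconn.nonempty
  choose f hf using fun x => hsq.exists_adj_ne hconn hcard x x
  obtain ⟨σ₀, hσ₀⟩ := hsq.exists_isAdjPerm fun v => (hf v).1
  choose f' hf' using fun x => hsq.exists_adj_ne hconn hcard x (σ₀ x)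
  obtain ⟨τ, hτ, hτσ⟩ := hσ₀.exists_ne (fun v => (hf' v).1) fun v => (hf' v).2
  obtain ⟨ρ, hρ, a, ha⟩ := hσ₀.exists_not_involutive hτ hτσ
  obtain ⟨σ, hσ, hle⟩ := exists_isCoarsest hρ
  have rot := hσ.rotation hsq hdeg
  -- `a`, `ρ a` and `ρ (ρ a)` are distinct and stay on one cycle after coarsening.
  have hla : σ (σ a) ≠ a := by
    intro e
    have h1 := rot.eq_or_of_two e (hle _ _ (by simp [Equiv.Perm.SameCycle.refl] : ρ.SameCycle a (ρ a)))
    have h2 := rot.eq_or_of_two e (hle _ _ (by simp [Equiv.Perm.SameCycle.refl] : ρ.SameCycle a (ρ (ρ a))))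
    have h3 := hρ.apply_ne a
    have h4 := hρ.apply_ne (ρ a)
    grind
  have hlong : ∀ x, σ (σ x) ≠ x := hconn.induction hla fun x y hxy hx => by
    by_cases hs : σ.SameCycle x y
    · exact rot.long_of_rel hx hs
    · intro hy
      exact rot.not_adj_of_two_of_long hy (rot.not_symm hs) hx hxy.symm
  obtain ⟨x, hx⟩ := hσ.exists_forall_sameCycle rot hlong
  let P : V → Prop := fun u => ∃ v, G.Adj u v ∧ ¬ σ.SameCycle u v
  have hPcycle : ∀ u v, σ.SameCycle u v → P u → P v := by
    intro u v huv hu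
    obtain ⟨n, rfl⟩ := rot.iter u v huv
    clear huv
    induction n with
    | zero => exact hu
    | succ n ih =>
      rw [Function.iterate_succ_apply']
      exact hsq.exists_adj_apply rot hlong ih
  have hP : ∀ u, ¬ P u := by
    intro u hu
    obtain ⟨v, hv, hD⟩ := hconn.induction hu (fun y z hyz hy => by
      by_cases hs : σ.SameCycle y z
      · exact hPcycle y z hs hy
      · exact ⟨y, hyz.symm, rot.not_symm hs⟩) x
    exact hD (hx v hv)
  have hall : ∀ y, σ.SameCycle x y := hconn.induction (.refl _ _) fun y z hyz hy => by
    by_contra hz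
    exact hP y ⟨z, hyz, fun h => hz (hy.trans h)⟩
  exact (hσ.adj.traces_toList x).isHamiltonian (σ.nodup_toList x) (rot.adj' x).symm
    (fun y => hσ.adj.mem_toList.2 (hall y)) hcard
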